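/- Let $\Omega\subset\mathbb R^2$ be a bounded domain (nonempty, open, connected) with $C^2$-smooth boundary that is convex and centrally symmetric, i.e. $-\Omega=\Omega$. Let $\mathcal H^1$ be the one-dimensional Hausdorff measure, $L=\mathcal H^1(\partial\Omega)$ the perimeter of $\Omega$, and $R=\frac{L}{2\pi}$. Then $0<R<\infty$, and the disk $\mathcal B=\{x\in\mathbb R^2:|x|<R\}$ has the same perimeter as $\Omega$. Put $\Omega_t=\{x\in\Omega:\operatorname{dist}(x,\partial\Omega)>t\}$ and $\mathcal B_t=\{x\in\mathcal B:\operatorname{dist}(x,\partial\mathcal B)>t\}$ for $t>0$, and let $r_{\rm i}=\max_{x\in\Omega}\operatorname{dist}(x,\partial\Omega)$ be the in-radius of $\Omega$. Then $\Omega$ is sub-ordinate to $\mathcal B$; that is, there exists $x_0\in\mathbb R^2$ such that for almost every $t\in(0,r_{\rm i})$ $$\int_{\partial\mathcal B_t}|x|^2\,d\mathcal H^1(x)=2\pi(R-t)^3\ \ge\ \int_{\partial\Omega_t}|x+x_0|^2\,d\mathcal H^1(x).$$ -/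

import Mathlib

open Set Metric MeasureTheory
open scoped ENNReal

/-- The Euclidean plane. -/
abbrev Plane : Type := EuclideanSpace ℝ (Fin 2)

/-- The boundary of `Ω` is `C²`-smooth: near each boundary point, `Ω` is the set where some
`C²` function with nonvanishing gradient at that point is negative. -/
def HasC2Boundary (Ω : Set Plane) : Prop :=
  ∀ p ∈ frontier Ω, ∃ (U : Set Plane) (φ : Plane → ℝ),
    IsOpen U ∧ p ∈ U ∧ ContDiffOn ℝ 2 φ U ∧ fderiv ℝ φ p ≠ 0 ∧
      Ω ∩ U = {x ∈ U | φ x < 0}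

/-- `Ω` is invariant under the involution `x ↦ -x`. -/
def CentrallySymmetric (Ω : Set Plane) : Prop :=
  (fun x : Plane => -x) '' Ω = Ω

/-- The perimeter `|∂Ω|`: one-dimensional Hausdorff measure of the boundary, in `[0, ∞]`. -/
noncomputable def perimeter (Ω : Set Plane) : ℝ≥0∞ :=
  Measure.hausdorffMeasure 1 (frontier Ω)

/-- The distance from `x` to the boundary of `Ω`. -/
noncomputable def boundaryDist (Ω : Set Plane) (x : Plane) : ℝ :=
  infDist x (frontier Ω)

/-- The in-radius of `Ω`: the largest value on `Ω` of the distance to the boundary. -/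
noncomputable def inradius (Ω : Set Plane) : ℝ :=
  sSup (boundaryDist Ω '' Ω)

/-- The inner parallel set `Ω_t`: the points of `Ω` whose distance to the boundary exceeds `t`. -/
def innerParallel (Ω : Set Plane) (t : ℝ) : Set Plane :=
  {x ∈ Ω | t < boundaryDist Ω x}

/-- The moment `∫_{∂G} |x + x₀|² dℋ¹(x)`, as a Lebesgue integral with values in `[0, ∞]`. -/
noncomputable def boundaryMoment (G : Set Plane) (x₀ : Plane) : ℝ≥0∞ :=
  ∫⁻ x in frontier G, ‖x + x₀‖ₑ ^ 2 ∂(Measure.hausdorffMeasure 1)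

/-- `Ω` is sub-ordinate to the disk `B` of radius `R` centred at the origin: for some `x₀` and
almost every `t ∈ (0, r_i)`,
`∫_{∂B_t} |x|² dℋ¹ = 2π (R - t)³ ≥ ∫_{∂Ω_t} |x + x₀|² dℋ¹`. -/
def SubordinateToDisk (Ω : Set Plane) (R : ℝ) : Prop :=
  ∃ x₀ : Plane, ∀ᵐ t ∂(volume.restrict (Ioo 0 (inradius Ω))),
    boundaryMoment (innerParallel (ball 0 R) t) 0 = ENNReal.ofReal (2 * Real.pi * (R - t) ^ 3) ∧
      boundaryMoment (innerParallel Ω t) x₀ ≤ boundaryMoment (innerParallel (ball 0 R) t) 0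

/-! The witness is `x₀ = 0`, the centre of symmetry, and the inequality holds for every `t` in the
interval. Two estimates combine. Let `a` be the length of half the boundary of the inner parallel
set, a symmetric convex body in its own right.

Length: `two_mul_eVariationOn_add_le_perimeter` gives `2 (a + π t) ≤ L`, so `a ≤ π (R - t)`. It is
Cauchy's formula: the length of a segment is a multiple of its mean absolute projection over all
directions. Over half a turn the projected boundary of a symmetric convex body rises to its maximum
and falls back, so its variation is twice that maximum, and passing from the inner set to the outer
body raises the maximum by at least `t`.

Moment: central symmetry makes a unit-speed parametrization `G` of half the boundary satisfy `G a =
-G 0`. Wirtinger's inequality for such curves (`integral_norm_sq_le_of_antipodal`) bounds the moment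
of each half by `a³ / π²`, so `boundaryMoment_le` bounds the total by `2 a³ / π² ≤ 2 π (R - t)³`.

Wirtinger's inequality is obtained from a discrete version in the limit, and lengths are suprema
over inscribed polygons, so no derivative of a boundary curve is needed. -/

/-! ### Wirtinger's inequality, discrete and continuous. -/

/-- Picone's identity for sequences with `φ (j + 2) + φ j = c * φ (j + 1)`. -/
lemma sum_picone (x φ : ℕ → ℝ) (c b : ℝ) (h0 : φ 1 + b = c * φ 0)
    (hrec : ∀ j, φ (j + 2) + φ j = c * φ (j + 1)) (m : ℕ) (hpos : ∀ j ≤ m, φ j ≠ 0) :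
    ∑ j ∈ Finset.range m, φ j * φ (j + 1) * (x (j + 1) / φ (j + 1) - x j / φ j) ^ 2 =
      ∑ j ∈ Finset.range m, (-2 * x j * x (j + 1)) + c * ∑ j ∈ Finset.range (m + 1), x j ^ 2
        - x 0 ^ 2 * (b / φ 0) - x m ^ 2 * (φ (m + 1) / φ m) := by
  induction m with
  | zero =>
    have := hpos 0 le_rfl
    simp
    field_simp
    linear_combination (x 0 ^ 2) * h0
  | succ m ih =>
    have h1 := hpos m (by omega)
    have h2 := hpos (m + 1) le_rfl
    rw [Finset.sum_range_succ, ih (fun j hj => hpos j (by omega))]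
    simp only [Finset.sum_range_succ]
    have h3 : φ (m + 2) = c * φ (m + 1) - φ m := by linear_combination hrec m
    rw [h3]
    field_simp
    ring

/-- The discrete Wirtinger inequality for antiperiodic sequences. -/
lemma discrete_wirtinger (x : ℕ → ℝ) (n : ℕ) (hn : 1 ≤ n) :
    4 * Real.sin (Real.pi / (2 * (n + 1))) ^ 2 * ∑ j ∈ Finset.range (n + 1), x j ^ 2 ≤
      ∑ j ∈ Finset.range n, (x (j + 1) - x j) ^ 2 + (x n + x 0) ^ 2 := by
  set α : ℝ := Real.pi / (2 * (n + 1)) with hα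
  have hn' : (0 : ℝ) < n + 1 := by positivity
  have hn1 : (1 : ℝ) ≤ n := by exact_mod_cast hn
  have hπ := Real.pi_pos
  have hα0 : 0 < α := by positivity
  have hαn : 2 * (n + 1) * α = Real.pi := by rw [hα]; field_simp
  have hα2 : 2 * α < Real.pi := by nlinarith
  -- The positive ground state of the antiperiodic second difference: `φ (n + 1) = -φ 0`, and its
  -- value at index `-1` is `-sin α`, which is the `b` passed to `sum_picone`.
  set φ : ℕ → ℝ := fun j => Real.sin ((2 * j + 1) * α) with hφ
  have hpos : ∀ j ≤ n, 0 < φ j := by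
    intro j hj
    have hj' : (j : ℝ) ≤ n := by exact_mod_cast hj
    refine Real.sin_pos_of_pos_of_lt_pi (by positivity) ?_
    nlinarith
  have hφ0 : φ 0 = Real.sin α := by simp [hφ]
  have hφn : φ n = Real.sin α := by
    simp only [hφ]
    rw [show (2 * (n : ℝ) + 1) * α = Real.pi - α by linarith, Real.sin_pi_sub]
  have hφn1 : φ (n + 1) = - Real.sin α := by
    simp only [hφ]
    push_cast
    rw [show (2 * ((n : ℝ) + 1) + 1) * α = α + Real.pi by linarith, Real.sin_add_pi]
  have hcn : Real.cos ((2 * n + 1) * α) = - Real.cos α := by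
    rw [show (2 * (n : ℝ) + 1) * α = Real.pi - α by linarith, Real.cos_pi_sub]
  have hs0 : 0 < Real.sin α := hφ0 ▸ hpos 0 (by omega)
  have hs2 : 0 < Real.sin (2 * α) := Real.sin_pos_of_pos_of_lt_pi (by positivity) hα2
  have hpic := sum_picone x φ (2 * Real.cos (2 * α)) (-Real.sin α)
    (by
      simp only [hφ]
      rw [show (2 * ((0 : ℕ) : ℝ) + 1) * α = α by push_cast; ring,
        show (2 * ((1 : ℕ) : ℝ) + 1) * α = 2 * α + α by push_cast; ring, Real.sin_add]
      rw [show Real.sin (2 * α) * Real.cos α = Real.sin α + Real.cos (2 * α) * Real.sin α by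
        rw [Real.sin_two_mul, Real.cos_two_mul]; ring]
      ring)
    (by
      intro j
      simp only [hφ]
      push_cast
      rw [show (2 * ((j : ℝ) + 2) + 1) * α = (2 * ((j : ℝ) + 1) + 1) * α + 2 * α by ring,
        show (2 * (j : ℝ) + 1) * α = (2 * ((j : ℝ) + 1) + 1) * α - 2 * α by ring,
        Real.sin_add, Real.sin_sub]
      ring) n (fun j hj => (hpos j hj).ne')
  -- The sum telescopes, because a difference of consecutive cotangents is `sin (2α) / (φ m * φ (m +
  -- 1))`.
  have hcot : ∀ m ≤ n, ∑ j ∈ Finset.range m, 1 / (φ j * φ (j + 1)) =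
      (Real.cos α / Real.sin α - Real.cos ((2 * m + 1) * α) / φ m) / Real.sin (2 * α) := by
    intro m
    induction m with
    | zero => intro _; simp [hφ0]
    | succ m ih =>
      intro hm
      rw [Finset.sum_range_succ, ih (by omega)]
      have h1 := (hpos m (by omega)).ne'
      have h2 := (hpos (m + 1) hm).ne'
      have h3 : Real.sin (2 * α) = φ (m + 1) * Real.cos ((2 * m + 1) * α)
          - Real.cos ((2 * (m + 1 : ℕ) + 1) * α) * φ m := by
        simp only [hφ]
        rw [← Real.sin_sub]
        push_cast
        congr 1
        ring
      have h4 : 1 / (φ m * φ (m + 1)) = (Real.cos ((2 * m + 1) * α) / φ m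
          - Real.cos ((2 * (m + 1 : ℕ) + 1) * α) / φ (m + 1)) / Real.sin (2 * α) := by
        rw [div_sub_div _ _ h1 h2, eq_div_iff hs2.ne', h3]
        ring
      rw [h4]
      ring
  -- Cauchy–Schwarz turns the Picone remainder into a bound by `(x n - x 0) ^ 2`; merely dropping
  -- the remainder would lose the cross term `x 0 * x n`.
  have hcs : (∑ j ∈ Finset.range n, (x (j + 1) / φ (j + 1) - x j / φ j)) ^ 2 ≤
      (∑ j ∈ Finset.range n, φ j * φ (j + 1) * (x (j + 1) / φ (j + 1) - x j / φ j) ^ 2) *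
        ∑ j ∈ Finset.range n, 1 / (φ j * φ (j + 1)) := by
    have hp : ∀ j ∈ Finset.range n, 0 < φ j * φ (j + 1) := by
      intro j hj
      have := Finset.mem_range.1 hj
      exact mul_pos (hpos j (by omega)) (hpos (j + 1) (by omega))
    apply Finset.sum_sq_le_sum_mul_sum_of_sq_le_mul
    · intro j hj
      have := hp j hj
      positivity
    · intro j hj
      have := hp j hj
      positivity
    · intro j hj
      refine le_of_eq ?_
      rw [mul_one_div, mul_div_cancel_left₀ _ (hp j hj).ne']
  rw [Finset.sum_range_sub (fun j => x j / φ j), hcot n le_rfl, hcn, hφn, hφ0, hpic, hφn1, hφn, hφ0,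
    show (Real.cos α / Real.sin α - -Real.cos α / Real.sin α) / Real.sin (2 * α) =
      1 / Real.sin α ^ 2 by
        have : Real.cos α ≠ 0 := by
          rw [Real.sin_two_mul] at hs2
          intro h
          simp [h] at hs2
        rw [Real.sin_two_mul]
        field_simp
        norm_num, ← sub_div, div_pow, mul_one_div, div_le_div_iff_of_pos_right (by positivity)] at hcs
  have e1 : -Real.sin α / Real.sin α = -1 := by field_simp
  rw [e1] at hcs
  have hsum : ∑ j ∈ Finset.range n, (x (j + 1) - x j) ^ 2 =
      ∑ j ∈ Finset.range n, (-2 * x j * x (j + 1)) + 2 * ∑ j ∈ Finset.range (n + 1), x j ^ 2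
        - x 0 ^ 2 - x n ^ 2 := by
    clear * -
    induction n with
    | zero => simp; ring
    | succ m ih =>
      rw [Finset.sum_range_succ, ih]
      simp only [Finset.sum_range_succ]
      ring
  rw [hsum]
  have hc2 : Real.cos (2 * α) = 1 - 2 * Real.sin α ^ 2 := by
    rw [Real.cos_two_mul, Real.cos_sq']; ring
  rw [hc2] at hcs
  linarith

lemma Plane.norm_sq (x : Plane) : ‖x‖ ^ 2 = x 0 ^ 2 + x 1 ^ 2 := by
  simp [EuclideanSpace.norm_sq_eq, Fin.sum_univ_two]

lemma discrete_wirtinger_plane (x : ℕ → Plane) (n : ℕ) (hn : 1 ≤ n) :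
    4 * Real.sin (Real.pi / (2 * (n + 1))) ^ 2 * ∑ j ∈ Finset.range (n + 1), ‖x j‖ ^ 2 ≤
      ∑ j ∈ Finset.range n, ‖x (j + 1) - x j‖ ^ 2 + ‖x n + x 0‖ ^ 2 := by
  have h0 := discrete_wirtinger (fun j => x j 0) n hn
  have h1 := discrete_wirtinger (fun j => x j 1) n hn
  simp only [Plane.norm_sq, PiLp.sub_apply, PiLp.add_apply, Finset.sum_add_distrib]
  rw [mul_add]
  linarith

/-- The Wirtinger inequality on `[0, a]` for `1`-Lipschitz curves with antipodal endpoints. -/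
lemma integral_norm_sq_le_of_antipodal {G : ℝ → Plane} (hG : LipschitzWith 1 G) {a : ℝ}
    (ha : 0 ≤ a) (hGa : G a = - G 0) :
    ∫ x in (0 : ℝ)..a, ‖G x‖ ^ 2 ≤ a ^ 3 / Real.pi ^ 2 := by
  have hcont : Continuous fun x => ‖G x‖ ^ 2 := by have := hG.continuous; fun_prop
  have hdist : ∀ x y, ‖G x - G y‖ ≤ |x - y| := fun x y => by
    simpa [dist_eq_norm, Real.dist_eq] using hG.dist_le_mul x y
  have key : ∀ n : ℕ, 1 ≤ n → (2 * (n + 1) * Real.sin (Real.pi / (2 * (n + 1)))) ^ 2 *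
      ∫ x in (0 : ℝ)..a, ‖G x‖ ^ 2 ≤ a ^ 3 := by
    intro n hn
    have hn0 : (0 : ℝ) < n + 1 := by positivity
    set h : ℝ := a / (n + 1) with hh
    have hh0 : 0 ≤ h := by positivity
    have hah : (n + 1) * h = a := by rw [hh]; field_simp
    -- Folding `[0, a]` onto `[0, h]` makes the integrand, at each offset, a sum over `n + 1`
    -- equally spaced points of the curve, to which the discrete inequality applies.
    have hsplit : ∫ x in (0 : ℝ)..a, ‖G x‖ ^ 2 =
        ∫ x in (0 : ℝ)..h, ∑ j ∈ Finset.range (n + 1), ‖G (x + j * h)‖ ^ 2 := by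
      rw [intervalIntegral.integral_finsetSum
        (fun j _ => Continuous.intervalIntegrable (by have := hG.continuous; fun_prop) _ _)]
      have := intervalIntegral.sum_integral_adjacent_intervals (a := fun j : ℕ => (j : ℝ) * h)
        (n := n + 1) (μ := volume) (f := fun x => ‖G x‖ ^ 2)
        (fun k _ => hcont.intervalIntegrable _ _)
      simp only [Nat.cast_zero, zero_mul] at this
      push_cast at this
      rw [hah] at this
      rw [← this]
      refine Finset.sum_congr rfl fun j _ => ?_
      rw [intervalIntegral.integral_comp_add_right (fun x => ‖G x‖ ^ 2) (j * h)]
      congr 1 <;> ring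
    have hpt : ∀ x ∈ Icc 0 h, 4 * Real.sin (Real.pi / (2 * (n + 1))) ^ 2 *
        ∑ j ∈ Finset.range (n + 1), ‖G (x + j * h)‖ ^ 2 ≤ (n + 1) * h ^ 2 := by
      intro x hx
      refine (discrete_wirtinger_plane (fun j => G (x + j * h)) n hn).trans ?_
      have h1 : ∀ j ∈ Finset.range n,
          ‖G (x + (j + 1 : ℕ) * h) - G (x + j * h)‖ ^ 2 ≤ h ^ 2 := by
        intro j _
        have := hdist (x + (j + 1 : ℕ) * h) (x + j * h)
        rw [show x + ((j + 1 : ℕ) : ℝ) * h - (x + j * h) = h by push_cast; ring,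
          abs_of_nonneg hh0] at this
        gcongr
      -- The wrap-around step: by antipodality it splits into increments over parameter lengths `h -
      -- x` and `x`.
      have h2 : ‖G (x + n * h) + G (x + (0 : ℕ) * h)‖ ≤ h := by
        have e : G (x + n * h) + G (x + (0 : ℕ) * h) = (G (x + n * h) - G a) + (G x - G 0) := by
          rw [hGa]; simp
        rw [e]
        refine (norm_add_le _ _).trans ?_
        have e1 := hdist (x + n * h) a
        have e2 := hdist x 0
        rw [abs_of_nonpos (by linarith [hx.2])] at e1
        rw [sub_zero, abs_of_nonneg hx.1] at e2
        linarith
      have h3 : ‖G (x + n * h) + G (x + (0 : ℕ) * h)‖ ^ 2 ≤ h ^ 2 := by gcongr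
      have h4 := Finset.sum_le_sum h1
      simp only [Finset.sum_const, Finset.card_range, nsmul_eq_mul] at h4
      linarith
    have hint := intervalIntegral.integral_mono_on (μ := volume) hh0
      (f := fun x => 4 * Real.sin (Real.pi / (2 * (n + 1))) ^ 2 *
        ∑ j ∈ Finset.range (n + 1), ‖G (x + j * h)‖ ^ 2) (g := fun _ => (n + 1) * h ^ 2)
      (Continuous.intervalIntegrable (by have := hG.continuous; fun_prop) _ _)
      (Continuous.intervalIntegrable (by fun_prop) _ _) hpt
    rw [intervalIntegral.integral_const_mul, ← hsplit, intervalIntegral.integral_const,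
      smul_eq_mul, sub_zero] at hint
    have := mul_le_mul_of_nonneg_left hint (sq_nonneg ((n : ℝ) + 1))
    calc _ = _ := ?_
      _ ≤ _ := this
      _ = _ := ?_
    · ring
    · rw [← hah]; ring
  have hlim : Filter.Tendsto (fun n : ℕ =>
      (2 * ((n : ℝ) + 1) * Real.sin (Real.pi / (2 * (n + 1)))) ^ 2 *
        ∫ x in (0 : ℝ)..a, ‖G x‖ ^ 2) Filter.atTop
      (nhds (Real.pi ^ 2 * ∫ x in (0 : ℝ)..a, ‖G x‖ ^ 2)) := by
    refine Filter.Tendsto.mul_const _ (Filter.Tendsto.pow ?_ 2)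
    have h1 : Filter.Tendsto (fun n : ℕ => Real.pi / 2 * (1 / ((n : ℝ) + 1))) Filter.atTop
        (nhds 0) := by
      simpa using tendsto_one_div_add_atTop_nhds_zero_nat.const_mul (Real.pi / 2)
    have h2 := ((Real.continuous_sinc.tendsto 0).comp h1).const_mul Real.pi
    rw [Real.sinc_zero, mul_one] at h2
    refine h2.congr fun n => ?_
    have hn0 : (0 : ℝ) < n + 1 := by positivity
    have hπ := Real.pi_pos
    simp only [Function.comp]
    rw [Real.sinc_of_ne_zero (by positivity),
      show Real.pi / 2 * (1 / ((n : ℝ) + 1)) = Real.pi / (2 * (n + 1)) by field_simp]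
    field_simp
  rw [le_div_iff₀ (by positivity), mul_comm]
  exact le_of_tendsto hlim (Filter.eventually_atTop.2 ⟨1, fun n hn => key n hn⟩)

/-! ### Symmetric convex bodies and polar coordinates. -/

/-- Nonempty bounded open convex sets of the plane that are symmetric about the origin. -/
structure IsSymmBody (K : Set Plane) : Prop where
  isOpen : IsOpen K
  nonempty : K.Nonempty
  isBounded : Bornology.IsBounded K
  convex : Convex ℝ K
  neg_mem : ∀ x ∈ K, -x ∈ K

/-- The unit vector with polar angle `θ`. -/
noncomputable def unitVec (θ : ℝ) : Plane := !₂[Real.cos θ, Real.sin θ]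

@[simp] lemma unitVec_zero (θ : ℝ) : unitVec θ 0 = Real.cos θ := rfl
@[simp] lemma unitVec_one (θ : ℝ) : unitVec θ 1 = Real.sin θ := rfl

lemma Plane.ext {x y : Plane} (h0 : x 0 = y 0) (h1 : x 1 = y 1) : x = y := by
  ext i; fin_cases i <;> assumption

@[simp] lemma norm_unitVec (θ : ℝ) : ‖unitVec θ‖ = 1 := by
  have : ‖unitVec θ‖ ^ 2 = 1 := by simp [Plane.norm_sq]
  exact (pow_eq_one_iff_of_nonneg (norm_nonneg _) two_ne_zero).1 this

lemma unitVec_ne_zero (θ : ℝ) : unitVec θ ≠ 0 := by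
  intro h; have := norm_unitVec θ; simp [h] at this

lemma unitVec_add_pi (θ : ℝ) : unitVec (θ + Real.pi) = -unitVec θ := by
  apply Plane.ext <;> simp

lemma exists_eq_smul_unitVec (x : Plane) : ∃ θ ∈ Ico 0 (2 * Real.pi), x = ‖x‖ • unitVec θ := by
  set z : ℂ := ⟨x 0, x 1⟩ with hz
  have hn : ‖z‖ = ‖x‖ := by
    have : ‖z‖ ^ 2 = ‖x‖ ^ 2 := by rw [Plane.norm_sq, ← Complex.normSq_eq_norm_sq, Complex.normSq_apply]; ring
    exact (sq_eq_sq₀ (norm_nonneg _) (norm_nonneg _)).1 this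
  have hre : ‖z‖ * Real.cos z.arg = x 0 := Complex.norm_mul_cos_arg z
  have him : ‖z‖ * Real.sin z.arg = x 1 := Complex.norm_mul_sin_arg z
  rw [hn] at hre him
  have h1 := Complex.neg_pi_lt_arg z
  have h2 := Complex.arg_le_pi z
  have hπ := Real.pi_pos
  by_cases h : 0 ≤ z.arg
  · exact ⟨z.arg, ⟨h, by linarith⟩, Plane.ext (by simp [hre]) (by simp [him])⟩
  · exact ⟨z.arg + 2 * Real.pi, ⟨by linarith, by linarith⟩,
      Plane.ext (by simp [hre]) (by simp [him])⟩

lemma norm_unitVec_sub_le (a b : ℝ) : ‖unitVec a - unitVec b‖ ≤ |a - b| := by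
  refine abs_le_of_sq_le_sq' ?_ (by positivity) |>.2
  have h1 : Real.cos (a - b) = 1 - 2 * Real.sin ((a - b) / 2) ^ 2 := by
    rw [show a - b = 2 * ((a - b) / 2) by ring, Real.cos_two_mul, Real.cos_sq']; ring_nf
  have h2 : Real.sin ((a - b) / 2) ^ 2 ≤ ((a - b) / 2) ^ 2 := by
    rw [sq_le_sq]; exact Real.abs_sin_le_abs
  rw [Plane.norm_sq, sq_abs]
  simp only [PiLp.sub_apply, unitVec_zero, unitVec_one]
  rw [Real.cos_sub] at h1
  nlinarith [Real.sin_sq_add_cos_sq a, Real.sin_sq_add_cos_sq b]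

/-! ### Projections and Cauchy's formula. -/

/-- The component of `x` in the direction with polar angle `φ`. -/
noncomputable def component (φ : ℝ) (x : Plane) : ℝ := x 0 * Real.cos φ + x 1 * Real.sin φ

lemma component_sub (φ : ℝ) (x y : Plane) :
    component φ (x - y) = component φ x - component φ y := by simp [component]; ring
lemma component_add (φ : ℝ) (x y : Plane) :
    component φ (x + y) = component φ x + component φ y := by simp [component]; ring
lemma component_neg (φ : ℝ) (x : Plane) : component φ (-x) = -component φ x := by
  simp [component]; ring
lemma component_smul (φ r : ℝ) (x : Plane) : component φ (r • x) = r * component φ x := by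
  simp [component]; ring
lemma component_unitVec (φ θ : ℝ) : component φ (unitVec θ) = Real.cos (θ - φ) := by
  simp [component, Real.cos_sub]
lemma component_add_pi (φ : ℝ) (x : Plane) : component (φ + Real.pi) x = -component φ x := by
  simp [component]; ring
lemma abs_component_le (φ : ℝ) (x : Plane) : |component φ x| ≤ ‖x‖ := by
  refine abs_le_of_sq_le_sq ?_ (norm_nonneg _)
  rw [Plane.norm_sq]
  unfold component
  nlinarith [Real.sin_sq_add_cos_sq φ, sq_nonneg (x 0 * Real.sin φ - x 1 * Real.cos φ)]
lemma continuous_component (φ : ℝ) : Continuous (component φ) := by unfold component; fun_prop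
lemma continuous_component_left (x : Plane) : Continuous fun φ => component φ x := by
  unfold component; fun_prop

lemma integral_abs_cos (α : ℝ) : ∫ φ in (0 : ℝ)..(2 * Real.pi), |Real.cos (α - φ)| = 4 := by
  have hper : Function.Periodic (fun x => |Real.cos x|) Real.pi := fun x => by
    simp [Real.cos_add_pi]
  have hint : ∀ a b, IntervalIntegrable (fun x => |Real.cos x|) volume a b := fun a b =>
    Continuous.intervalIntegrable (by fun_prop) _ _
  have h1 : ∀ a, ∫ x in a..a + Real.pi, |Real.cos x| = 2 := by
    intro a
    rw [hper.intervalIntegral_add_eq a (-(Real.pi / 2)),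
      show -(Real.pi / 2) + Real.pi = Real.pi / 2 by ring]
    have : ∫ x in (-(Real.pi / 2))..(Real.pi / 2), |Real.cos x| =
        ∫ x in (-(Real.pi / 2))..(Real.pi / 2), Real.cos x := by
      refine intervalIntegral.integral_congr fun x hx => ?_
      rw [uIcc_of_le (by linarith [Real.pi_pos])] at hx
      exact abs_of_nonneg (Real.cos_nonneg_of_mem_Icc hx)
    rw [this, integral_cos]
    simp
    norm_num
  rw [intervalIntegral.integral_comp_sub_left (fun x => |Real.cos x|) α,
    ← intervalIntegral.integral_add_adjacent_intervals (hint _ (α - 2 * Real.pi + Real.pi))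
      (hint _ _), h1, show α - 0 = α - 2 * Real.pi + Real.pi + Real.pi by ring, h1]
  norm_num

/-- The Cauchy formula for the length of a segment. -/
lemma integral_abs_component (x : Plane) :
    ∫ φ in (0 : ℝ)..(2 * Real.pi), |component φ x| = 4 * ‖x‖ := by
  obtain ⟨α, -, hα⟩ := exists_eq_smul_unitVec x
  have : ∀ φ, |component φ x| = ‖x‖ * |Real.cos (α - φ)| := fun φ => by
    conv_lhs => rw [hα, component_smul, component_unitVec, abs_mul, abs_norm]
  simp_rw [this]
  rw [intervalIntegral.integral_const_mul, integral_abs_cos, mul_comm]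

/-! ### The gauge and the radial parametrization of the boundary. -/

namespace IsSymmBody

variable {K : Set Plane} (hK : IsSymmBody K)
include hK

lemma zero_mem : (0 : Plane) ∈ K := by
  obtain ⟨x, hx⟩ := hK.nonempty
  have := hK.convex hx (hK.neg_mem x hx) (a := 1 / 2) (b := 1 / 2) (by norm_num) (by norm_num)
    (by norm_num)
  simpa using this

lemma mem_nhds : K ∈ nhds (0 : Plane) := hK.isOpen.mem_nhds hK.zero_mem

lemma gauge_pos {x : Plane} (hx : x ≠ 0) : 0 < gauge K x :=
  (_root_.gauge_pos (absorbent_nhds_zero hK.mem_nhds)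
    ((NormedSpace.isVonNBounded_iff ℝ).2 hK.isBounded)).2 hx

lemma gauge_neg (x : Plane) : gauge K (-x) = gauge K x := _root_.gauge_neg hK.neg_mem x

lemma gauge_add_le (x y : Plane) : gauge K (x + y) ≤ gauge K x + gauge K y :=
  _root_.gauge_add_le hK.convex (absorbent_nhds_zero hK.mem_nhds) x y

lemma mem_frontier_iff {x : Plane} : x ∈ frontier K ↔ gauge K x = 1 :=
  (gauge_eq_one_iff_mem_frontier hK.convex hK.mem_nhds).symm

lemma exists_gauge_lower_bound : ∃ m : ℝ, 0 < m ∧ ∀ θ, m ≤ gauge K (unitVec θ) := by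
  obtain ⟨r, hr, hs⟩ := hK.isBounded.subset_closedBall_lt 0 0
  refine ⟨1 / r, by positivity, fun θ => ?_⟩
  have := le_gauge_of_subset_closedBall (absorbent_nhds_zero hK.mem_nhds) hr.le hs
    (x := unitVec θ)
  simpa using this

end IsSymmBody

/-- The parametrization of the boundary of `K` by the polar angle. -/
noncomputable def radialCurve (K : Set Plane) (θ : ℝ) : Plane :=
  (gauge K (unitVec θ))⁻¹ • unitVec θ

namespace IsSymmBody

variable {K : Set Plane} (hK : IsSymmBody K)
include hK

lemma gauge_unitVec_pos (θ : ℝ) : 0 < gauge K (unitVec θ) := hK.gauge_pos (unitVec_ne_zero θ)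

lemma radialCurve_mem_frontier (θ : ℝ) : radialCurve K θ ∈ frontier K := by
  rw [hK.mem_frontier_iff, radialCurve,
    gauge_smul_of_nonneg (inv_nonneg.2 (hK.gauge_unitVec_pos θ).le), smul_eq_mul,
    inv_mul_cancel₀ (hK.gauge_unitVec_pos θ).ne']

lemma radialCurve_add_pi (θ : ℝ) : radialCurve K (θ + Real.pi) = -radialCurve K θ := by
  rw [radialCurve, unitVec_add_pi, hK.gauge_neg, smul_neg, radialCurve]

lemma exists_radialCurve_eq {x : Plane} (hx : x ∈ frontier K) :
    ∃ θ ∈ Icc 0 Real.pi, x = radialCurve K θ ∨ x = -radialCurve K θ := by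
  obtain ⟨θ, hθ, h⟩ := exists_eq_smul_unitVec x
  rw [hK.mem_frontier_iff] at hx
  have h1 : ‖x‖ = (gauge K (unitVec θ))⁻¹ := by
    rw [h, gauge_smul_of_nonneg (norm_nonneg _), smul_eq_mul] at hx
    exact eq_inv_of_mul_eq_one_left hx
  have h2 : x = radialCurve K θ := by rw [radialCurve, ← h1, ← h]
  by_cases hle : θ ≤ Real.pi
  · exact ⟨θ, ⟨hθ.1, hle⟩, Or.inl h2⟩
  · push Not at hle
    refine ⟨θ - Real.pi, ⟨by linarith, by linarith [hθ.2]⟩, Or.inr ?_⟩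
    rw [← hK.radialCurve_add_pi, sub_add_cancel, h2]

lemma exists_lipschitzWith_radialCurve : ∃ C : NNReal, LipschitzWith C (radialCurve K) := by
  obtain ⟨m, hm, hlow⟩ := hK.exists_gauge_lower_bound
  obtain ⟨D, hD⟩ := hK.convex.lipschitz_gauge hK.mem_nhds
  -- Product rule: the inverse gauge is at most `1 / m` and is `D / m ^ 2`-Lipschitz in the angle,
  -- while `unitVec` is 1-Lipschitz of norm one.
  refine ⟨⟨1 / m + D / m ^ 2, by positivity⟩, LipschitzWith.of_dist_le_mul fun a b => ?_⟩
  rw [dist_eq_norm, Real.dist_eq]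
  change _ ≤ (1 / m + D / m ^ 2) * |a - b|
  have ha := hK.gauge_unitVec_pos a
  have hb := hK.gauge_unitVec_pos b
  have h1 : |gauge K (unitVec a) - gauge K (unitVec b)| ≤ D * |a - b| := by
    refine (hD.dist_le_mul _ _).trans ?_
    rw [dist_eq_norm]
    have := norm_unitVec_sub_le a b
    gcongr
  have e : radialCurve K a - radialCurve K b = (gauge K (unitVec a))⁻¹ • (unitVec a - unitVec b) +
      ((gauge K (unitVec a))⁻¹ - (gauge K (unitVec b))⁻¹) • unitVec b := by
    simp only [radialCurve, smul_sub, sub_smul]; abel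
  rw [e]
  refine (norm_add_le _ _).trans ?_
  rw [norm_smul, norm_smul, norm_unitVec, mul_one, Real.norm_of_nonneg (by positivity),
    Real.norm_eq_abs, add_mul]
  have h2 : (gauge K (unitVec a))⁻¹ ≤ 1 / m := by
    rw [one_div]; exact inv_anti₀ hm (hlow a)
  have h3 : |(gauge K (unitVec a))⁻¹ - (gauge K (unitVec b))⁻¹| ≤ D / m ^ 2 * |a - b| := by
    rw [inv_sub_inv ha.ne' hb.ne', abs_div, abs_of_pos (mul_pos ha hb), abs_sub_comm,
      div_mul_eq_mul_div]
    have hm2 : m ^ 2 ≤ gauge K (unitVec a) * gauge K (unitVec b) := by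
      rw [sq]; exact mul_le_mul (hlow a) (hlow b) hm.le ha.le
    exact div_le_div₀ (by positivity) h1 (by positivity) hm2
  exact add_le_add (mul_le_mul h2 (norm_unitVec_sub_le a b) (norm_nonneg _) (by positivity)) h3

lemma continuous_radialCurve : Continuous (radialCurve K) := by
  obtain ⟨C, hC⟩ := hK.exists_lipschitzWith_radialCurve
  exact hC.continuous

/-! ### Each projection of the boundary is unimodal. -/

lemma component_radialCurve_mul (φ θ : ℝ) :
    component φ (radialCurve K θ) * gauge K (unitVec θ) = Real.cos (θ - φ) := by
  rw [radialCurve, component_smul, component_unitVec]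
  have := (hK.gauge_unitVec_pos θ).ne'
  field_simp

/-- If `θ₂` lies in the angular sector spanned by `θ₁` and `θ₃`, a nonnegative component is at
least as large at `θ₂` as at `θ₁`, provided it is not smaller at `θ₃`. -/
lemma component_le_of_sector {φ θ₁ θ₂ θ₃ p q r : ℝ} (hp : 0 ≤ p) (hq : 0 ≤ q) (hr : 0 < r)
    (hvec : r • unitVec θ₂ = p • unitVec θ₁ + q • unitVec θ₃)
    (h0 : 0 ≤ component φ (radialCurve K θ₁))
    (h : component φ (radialCurve K θ₁) ≤ component φ (radialCurve K θ₃)) :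
    component φ (radialCurve K θ₁) ≤ component φ (radialCurve K θ₂) := by
  have hg : r * gauge K (unitVec θ₂) ≤ p * gauge K (unitVec θ₁) + q * gauge K (unitVec θ₃) := by
    have := hK.gauge_add_le (p • unitVec θ₁) (q • unitVec θ₃)
    rwa [← hvec, gauge_smul_of_nonneg hr.le, gauge_smul_of_nonneg hp,
      gauge_smul_of_nonneg hq] at this
  have hc := congrArg (component φ) hvec
  rw [component_add, component_smul, component_smul, component_smul, component_unitVec,
    component_unitVec, component_unitVec, ← hK.component_radialCurve_mul,
    ← hK.component_radialCurve_mul φ θ₁, ← hK.component_radialCurve_mul φ θ₃] at hc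
  have hg2 := hK.gauge_unitVec_pos θ₂
  have hg3 := hK.gauge_unitVec_pos θ₃
  have hpos : 0 < r * gauge K (unitVec θ₂) := by positivity
  refine le_of_mul_le_mul_right ?_ hpos
  -- Weighted by gauges, the component at `θ₂` is a combination of those at `θ₁` and `θ₃`;
  -- subadditivity of the gauge bounds the total weight from below.
  have h5 := mul_le_mul_of_nonneg_left hg h0
  have h6 := mul_le_mul_of_nonneg_left h (mul_nonneg hq hg3.le)
  linarith

/-- Where the component at `a` is nonnegative, `b` lies in the sector from `a` to the maximum `c`.
Where the component at `b` is nonpositive, reversing the direction and using the minimum at `c - π`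
gives the same argument. Opposite signs need nothing. -/
lemma monotoneOn_component {φ c : ℝ}
    (hmax : ∀ θ, component φ (radialCurve K θ) ≤ component φ (radialCurve K c)) :
    MonotoneOn (fun θ => component φ (radialCurve K θ)) (Icc (c - Real.pi) c) := by
  have hc' : component φ (radialCurve K (c - Real.pi)) = -component φ (radialCurve K c) := by
    have := hK.radialCurve_add_pi (c - Real.pi)
    rw [sub_add_cancel] at this
    rw [this, component_neg, neg_neg]
  have hmin : ∀ θ, component φ (radialCurve K (c - Real.pi)) ≤ component φ (radialCurve K θ) := by
    intro θ
    have := hmax (θ + Real.pi)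
    rw [hK.radialCurve_add_pi, component_neg] at this
    linarith
  intro a ha b hb hab
  simp only
  rcases eq_or_lt_of_le ha.1 with h1 | h1
  · rw [← h1]; exact hmin b
  rcases eq_or_lt_of_le hb.2 with h2 | h2
  · rw [h2]; exact hmax a
  have hsin : ∀ x y, x ≤ y → y ≤ x + Real.pi → 0 ≤ Real.sin (y - x) := fun x y h h' =>
    Real.sin_nonneg_of_nonneg_of_le_pi (by linarith) (by linarith)
  rcases le_total 0 (component φ (radialCurve K a)) with h3 | h3
  · refine hK.component_le_of_sector (hsin b c hb.2 (by linarith [hb.1]))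
      (hsin a b hab (by linarith [ha.1, hb.2])) (r := Real.sin (c - a))
      (Real.sin_pos_of_pos_of_lt_pi (by linarith) (by linarith)) ?_ h3 (hmax a)
    apply Plane.ext <;> simp [Real.sin_sub] <;> ring
  rcases le_total 0 (component φ (radialCurve K b)) with h4 | h4
  · exact h3.trans h4
  have := hK.component_le_of_sector (φ := φ + Real.pi) (θ₁ := b) (θ₂ := a) (θ₃ := c - Real.pi)
    (hsin (c - Real.pi) a ha.1 (by linarith [ha.2]))
    (hsin a b hab (by linarith [ha.1, hb.2])) (r := Real.sin (b - (c - Real.pi)))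
    (Real.sin_pos_of_pos_of_lt_pi (by linarith) (by linarith))
    (by apply Plane.ext <;> simp [Real.sin_sub, Real.cos_sub] <;> ring)
    (by rw [component_add_pi]; linarith)
    (by rw [component_add_pi, component_add_pi]; linarith [hmin b])
  rw [component_add_pi, component_add_pi] at this
  linarith

/-- The component of the boundary curve has variation at most `2 B` over half a turn, where `B` is
its maximum. -/
lemma exists_eVariationOn_component_le (φ : ℝ) : ∃ p ∈ frontier K, 0 ≤ component φ p ∧
    eVariationOn (fun θ => component φ (radialCurve K θ)) (Icc 0 Real.pi) ≤
      ENNReal.ofReal (2 * component φ p) := by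
  have hcont : Continuous fun θ => component φ (radialCurve K θ) :=
    (continuous_component φ).comp hK.continuous_radialCurve
  obtain ⟨c, hc, hmaxc⟩ := isCompact_Icc.exists_isMaxOn (nonempty_Icc.2 Real.pi_pos.le)
    hcont.abs.continuousOn
  have hmax : ∀ θ, |component φ (radialCurve K θ)| ≤ |component φ (radialCurve K c)| := by
    intro θ
    obtain ⟨ψ, hψ, h⟩ := hK.exists_radialCurve_eq (hK.radialCurve_mem_frontier θ)
    have hm := hmaxc hψ
    simp only [mem_ofPred_eq] at hm
    rcases h with h | h
    · rw [h]; exact hm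
    · rw [h, component_neg, abs_neg]; exact hm
  have main : ∀ ψ : ℝ, (∀ θ, component ψ (radialCurve K θ) ≤ component ψ (radialCurve K c)) →
      eVariationOn (fun θ => component ψ (radialCurve K θ)) (Icc 0 Real.pi) ≤
        ENNReal.ofReal (2 * component ψ (radialCurve K c)) := by
    intro ψ hψ
    have hmono := hK.monotoneOn_component hψ
    have hper : ∀ θ, component ψ (radialCurve K (θ + Real.pi)) =
        -component ψ (radialCurve K θ) := fun θ => by rw [hK.radialCurve_add_pi, component_neg]
    have h1 : eVariationOn (fun θ => component ψ (radialCurve K θ)) (Icc 0 c) ≤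
        ENNReal.ofReal (component ψ (radialCurve K c) - component ψ (radialCurve K 0)) := by
      have hm : MonotoneOn (fun θ => component ψ (radialCurve K θ)) (Icc 0 c) :=
        hmono.mono (Icc_subset_Icc_left (by linarith [hc.2]))
      simpa using (hm.eVariationOn_eq (left_mem_Icc.2 hc.1) (right_mem_Icc.2 hc.1)).le
    have h2 : eVariationOn (fun θ => component ψ (radialCurve K θ)) (Icc c Real.pi) ≤
        ENNReal.ofReal (component ψ (radialCurve K c) - component ψ (radialCurve K Real.pi)) := by
      -- Past `c` the component decreases: antiperiodicity carries the interval back into `[c - π,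
      -- c]`. Reversing the direction restates this as monotonicity.
      have hm : MonotoneOn (fun θ => component (ψ + Real.pi) (radialCurve K θ))
          (Icc c Real.pi) := by
        intro x hx y hy hxy
        have := hmono (a := x - Real.pi) (b := y - Real.pi)
          ⟨by linarith [hx.1], by linarith [hx.2, hc.1]⟩ ⟨by linarith [hy.1], by linarith [hy.2, hc.1]⟩
          (by linarith)
        have e1 := hper (x - Real.pi)
        have e2 := hper (y - Real.pi)
        rw [sub_add_cancel] at e1 e2
        simp only [component_add_pi] at this ⊢
        linarith
      have := (hm.eVariationOn_eq (left_mem_Icc.2 hc.2) (right_mem_Icc.2 hc.2)).le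
      rw [inter_self] at this
      simp only [component_add_pi] at this
      have e : eVariationOn (fun θ => component ψ (radialCurve K θ)) (Icc c Real.pi) =
          eVariationOn (fun θ => -component ψ (radialCurve K θ)) (Icc c Real.pi) := by
        simp only [eVariationOn, edist_neg_neg]
      rw [e]
      refine this.trans (le_of_eq ?_)
      congr 1
      ring
    have h3 := eVariationOn.Icc_add_Icc (fun θ => component ψ (radialCurve K θ)) (s := univ)
      hc.1 hc.2 (mem_univ _)
    simp only [univ_inter] at h3
    rw [← h3]
    refine (add_le_add h1 h2).trans ?_
    -- The two variations add up to `2 B` because the endpoint values at `0` and `π` are opposite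
    -- and cancel.
    have := hper 0
    rw [zero_add] at this
    rw [← ENNReal.ofReal_add (by linarith [hψ 0]) (by linarith [hψ Real.pi])]
    refine ENNReal.ofReal_le_ofReal ?_
    linarith
  rcases le_total 0 (component φ (radialCurve K c)) with h | h
  · exact ⟨radialCurve K c, hK.radialCurve_mem_frontier c, h, main φ fun θ =>
      (le_abs_self _).trans ((hmax θ).trans (abs_of_nonneg h).le)⟩
  · refine ⟨radialCurve K (c + Real.pi), hK.radialCurve_mem_frontier _, ?_⟩
    have := main (φ + Real.pi) fun θ => by
      rw [component_add_pi, component_add_pi]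
      exact (neg_le_abs _).trans ((hmax θ).trans (abs_of_nonpos h).le)
    simp only [component_add_pi] at this
    rw [hK.radialCurve_add_pi, component_neg]
    refine ⟨neg_nonneg.2 h, ?_⟩
    refine le_of_eq_of_le ?_ this
    simp only [eVariationOn, edist_neg_neg]

end IsSymmBody

/-! ### Hausdorff measure of arcs and inscribed polygons. -/

/-- The length of an arc is at least the length of its chord. -/
lemma edist_le_hausdorffMeasure_image_Ico {f : ℝ → Plane} (hf : Continuous f) {a b : ℝ}
    (hab : a ≤ b) : edist (f a) (f b) ≤ Measure.hausdorffMeasure 1 (f '' Ico a b) := by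
  -- Distance to `f a` is 1-Lipschitz, and by the intermediate value theorem it covers an interval
  -- as long as the chord.
  have h1 : Ico 0 (dist (f b) (f a)) ⊆ (fun x => dist x (f a)) '' (f '' Ico a b) := by
    rw [image_image]
    have := intermediate_value_Ico hab (f := fun x => dist (f x) (f a)) (by fun_prop)
    simpa using this
  have hL : LipschitzWith 1 fun x : Plane => dist x (f a) := LipschitzWith.dist_left _
  have h2 := hL.hausdorffMeasure_image_le (zero_le_one) (f '' Ico a b)
  rw [hausdorffMeasure_real] at h2
  refine le_trans (le_of_eq ?_) ((measure_mono h1).trans (h2.trans (by simp)))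
  rw [Real.volume_Ico, sub_zero, edist_dist, dist_comm]

namespace IsSymmBody

variable {K : Set Plane} (hK : IsSymmBody K)
include hK

lemma unitVec_eq_of_radialCurve_eq {a b : ℝ} (h : radialCurve K a = radialCurve K b) :
    unitVec a = unitVec b := by
  have ha := hK.gauge_unitVec_pos a
  have hb := hK.gauge_unitVec_pos b
  have hn := congrArg norm h
  simp only [radialCurve, norm_smul, norm_unitVec, mul_one] at hn
  rw [Real.norm_of_nonneg (by positivity), Real.norm_of_nonneg (by positivity)] at hn
  rw [radialCurve, radialCurve, hn] at h
  exact smul_right_injective Plane (inv_ne_zero hb.ne') h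

lemma injOn_radialCurve : InjOn (radialCurve K) (Ico 0 Real.pi) := by
  intro a ha b hb h
  have h0 := congrArg (fun x : Plane => x 0) (hK.unitVec_eq_of_radialCurve_eq h)
  exact Real.injOn_cos ⟨ha.1, ha.2.le⟩ ⟨hb.1, hb.2.le⟩ h0

/-- Half-open arcs over consecutive parameter intervals are disjoint by injectivity, so their
measures add, and each dominates its chord. -/
lemma sum_edist_le_hausdorffMeasure {u : ℕ → ℝ} (hu : Monotone u) (n : ℕ) (h0 : 0 ≤ u 0)
    (hn : u n ≤ Real.pi) :
    ∑ i ∈ Finset.range n, edist (radialCurve K (u (i + 1))) (radialCurve K (u i)) ≤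
      Measure.hausdorffMeasure 1 (radialCurve K '' Ico (u 0) (u n)) := by
  induction n with
  | zero => simp
  | succ n ih =>
    have h1 : u n ≤ u (n + 1) := hu (Nat.le_succ n)
    have h2 : u 0 ≤ u n := hu (Nat.zero_le n)
    rw [Finset.sum_range_succ, ← Ico_union_Ico_eq_Ico h2 h1, image_union, measure_union]
    · refine add_le_add (ih (h1.trans hn)) ?_
      rw [edist_comm]
      exact edist_le_hausdorffMeasure_image_Ico hK.continuous_radialCurve h1
    · rw [Set.disjoint_left]
      rintro _ ⟨a, ha, rfl⟩ ⟨b, hb, hab⟩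
      have := hK.injOn_radialCurve ⟨h0.trans (h2.trans hb.1), hb.2.trans_le hn⟩
        ⟨h0.trans ha.1, ha.2.trans_le (h1.trans hn)⟩ hab
      linarith [ha.2, hb.1]
    · exact measurableSet_Ico.image_of_continuousOn_injOn hK.continuous_radialCurve.continuousOn
        (hK.injOn_radialCurve.mono (Ico_subset_Ico (h0.trans h2) hn))

/-- The perimeter is at least twice the length of any polygon inscribed in half of the boundary. -/
lemma two_mul_sum_edist_le_perimeter {u : ℕ → ℝ} (hu : Monotone u) (n : ℕ) (h0 : 0 ≤ u 0)
    (hn : u n ≤ Real.pi) :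
    2 * ∑ i ∈ Finset.range n, edist (radialCurve K (u (i + 1))) (radialCurve K (u i)) ≤
      perimeter K := by
  set A := radialCurve K '' Ico 0 Real.pi with hA
  have hAm : MeasurableSet A :=
    measurableSet_Ico.image_of_continuousOn_injOn hK.continuous_radialCurve.continuousOn
      hK.injOn_radialCurve
  have hle : ∑ i ∈ Finset.range n, edist (radialCurve K (u (i + 1))) (radialCurve K (u i)) ≤
      Measure.hausdorffMeasure 1 A :=
    (hK.sum_edist_le_hausdorffMeasure hu n h0 hn).trans
      (measure_mono (image_mono (Ico_subset_Ico h0 hn)))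
  have hneg : Measure.hausdorffMeasure 1 ((fun x : Plane => -x) '' A) =
      Measure.hausdorffMeasure 1 A :=
    (IsometryEquiv.neg Plane).hausdorffMeasure_image 1 A
  have hdisj : Disjoint ((fun x : Plane => -x) '' A) A := by
    rw [Set.disjoint_left]
    rintro _ ⟨_, ⟨a, ha, rfl⟩, rfl⟩ ⟨b, hb, hab⟩
    simp only at hab
    rw [← hK.radialCurve_add_pi] at hab
    have hv := hK.unitVec_eq_of_radialCurve_eq hab
    have e0 := congrArg (fun x : Plane => x 0) hv
    have e1 := congrArg (fun x : Plane => x 1) hv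
    simp only [unitVec_zero, unitVec_one, Real.cos_add_pi, Real.sin_add_pi] at e0 e1
    have s1 := Real.sin_nonneg_of_nonneg_of_le_pi ha.1 ha.2.le
    have s2 := Real.sin_nonneg_of_nonneg_of_le_pi hb.1 hb.2.le
    have z1 : a = 0 := by
      by_contra hne
      have := Real.sin_pos_of_pos_of_lt_pi (lt_of_le_of_ne ha.1 (Ne.symm hne)) ha.2
      linarith
    have z2 : b = 0 := by
      by_contra hne
      have := Real.sin_pos_of_pos_of_lt_pi (lt_of_le_of_ne hb.1 (Ne.symm hne)) hb.2
      linarith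
    rw [z1, z2, Real.cos_zero] at e0
    norm_num at e0
  have hsub : (fun x : Plane => -x) '' A ∪ A ⊆ frontier K := by
    rintro x (⟨_, ⟨a, ha, rfl⟩, rfl⟩ | ⟨a, ha, rfl⟩)
    · simp only
      rw [← hK.radialCurve_add_pi]
      exact hK.radialCurve_mem_frontier _
    · exact hK.radialCurve_mem_frontier _
  calc _ ≤ 2 * Measure.hausdorffMeasure 1 A := by gcongr
    _ = Measure.hausdorffMeasure 1 ((fun x : Plane => -x) '' A ∪ A) := by
      rw [measure_union hdisj hAm, hneg, two_mul]
    _ ≤ _ := measure_mono hsub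

lemma perimeter_lt_top : perimeter K < ∞ := by
  obtain ⟨C, hC⟩ := hK.exists_lipschitzWith_radialCurve
  have hsub : frontier K ⊆ radialCurve K '' Icc 0 (2 * Real.pi) := by
    intro x hx
    obtain ⟨θ, hθ, h | h⟩ := hK.exists_radialCurve_eq hx
    · exact ⟨θ, ⟨hθ.1, by linarith [hθ.2, Real.pi_pos]⟩, h.symm⟩
    · exact ⟨θ + Real.pi, ⟨by linarith [hθ.1, Real.pi_pos], by linarith [hθ.2]⟩,
        by rw [hK.radialCurve_add_pi, h]⟩
  refine (measure_mono hsub).trans_lt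
    ((hC.hausdorffMeasure_image_le zero_le_one _).trans_lt ?_)
  rw [hausdorffMeasure_real, Real.volume_Icc]
  exact ENNReal.mul_lt_top (by simp) ENNReal.ofReal_lt_top

/-! ### Comparing lengths of nested bodies through projections. -/

/-- The projections of finely inscribed polygons nearly cover the projection of the boundary. -/
lemma two_mul_abs_component_le {C : NNReal} (hC : LipschitzWith C (radialCurve K)) (φ : ℝ)
    {y : Plane} (hy : y ∈ frontier K) (N : ℕ) (hN : 0 < N) :
    2 * |component φ y| ≤ ∑ j ∈ Finset.range N,
      |component φ (radialCurve K (((j + 1 : ℕ) : ℝ) * (Real.pi / N)) -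
        radialCurve K ((j : ℝ) * (Real.pi / N)))| + 2 * (C * (Real.pi / N)) := by
  have hN0 : (0 : ℝ) < N := by exact_mod_cast hN
  have hπ := Real.pi_pos
  have hh : 0 < Real.pi / N := by positivity
  obtain ⟨θ, hθ, hyθ⟩ := hK.exists_radialCurve_eq hy
  have habs : |component φ y| = |component φ (radialCurve K θ)| := by
    rcases hyθ with h | h <;> simp [h, component_neg]
  set k := ⌊θ / (Real.pi / N)⌋₊ with hk
  have hkle : (k : ℝ) * (Real.pi / N) ≤ θ := by
    rw [← le_div_iff₀ hh]; exact Nat.floor_le (div_nonneg hθ.1 hh.le)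
  have hklt : θ < (k + 1) * (Real.pi / N) := by
    rw [← div_lt_iff₀ hh]; exact Nat.lt_floor_add_one _
  have hkN : k ≤ N := by
    have : (k : ℝ) * (Real.pi / N) ≤ N * (Real.pi / N) := by
      rw [mul_div_cancel₀ _ hN0.ne']; exact hkle.trans hθ.2
    exact_mod_cast le_of_mul_le_mul_right this hh
  set f : ℕ → ℝ := fun j => component φ (radialCurve K ((j : ℝ) * (Real.pi / N))) with hf
  have hnear : |component φ (radialCurve K θ)| ≤ |f k| + C * (Real.pi / N) := by
    have h1 : |component φ (radialCurve K θ) - f k| ≤ C * (Real.pi / N) := by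
      rw [hf, ← component_sub]
      refine (abs_component_le _ _).trans ?_
      rw [← dist_eq_norm]
      refine (hC.dist_le_mul _ _).trans ?_
      rw [Real.dist_eq, abs_of_nonneg (by linarith)]
      gcongr
      linarith
    have := abs_sub_abs_le_abs_sub (component φ (radialCurve K θ)) (f k)
    linarith
  -- The walk `f` from `f 0` to `-f 0` through `f k` has variation at least `|f k - f 0| + |f k + f
  -- 0| ≥ 2 |f k|`.
  have hanti : f N = -f 0 := by
    simp only [hf]
    rw [mul_div_cancel₀ _ hN0.ne', ← component_neg, ← hK.radialCurve_add_pi]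
    simp
  have hs1 := dist_le_Ico_sum_dist f (Nat.zero_le k)
  have hs2 := dist_le_Ico_sum_dist f hkN
  have hsum : ∑ j ∈ Finset.range N,
      |component φ (radialCurve K (((j + 1 : ℕ) : ℝ) * (Real.pi / N)) -
        radialCurve K ((j : ℝ) * (Real.pi / N)))| =
      ∑ i ∈ Finset.Ico 0 k, dist (f i) (f (i + 1)) +
        ∑ i ∈ Finset.Ico k N, dist (f i) (f (i + 1)) := by
    rw [Finset.sum_Ico_consecutive _ (Nat.zero_le k) hkN, ← Finset.range_eq_Ico]
    refine Finset.sum_congr rfl fun j _ => ?_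
    rw [dist_comm, Real.dist_eq, component_sub]
  rw [hsum, habs]
  rw [Real.dist_eq, abs_sub_comm] at hs1
  rw [Real.dist_eq, hanti, sub_neg_eq_add] at hs2
  have h3 : 2 * |f k| ≤ |f k - f 0| + |f k + f 0| := by
    have := abs_add_le (f k - f 0) (f k + f 0)
    rw [show f k - f 0 + (f k + f 0) = 2 * f k by ring, abs_mul, abs_two] at this
    exact this
  linarith

/-- Moving `p` by `t` in direction `φ` stays in the closure of `K`; dilating the result out to the
boundary cannot shrink the absolute component. -/
lemma exists_component_add_le {A : Set Plane} {t : ℝ}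
    (hsub : ∀ x ∈ A, ∀ v, ‖v‖ ≤ t → x + v ∈ K) (ht : 0 ≤ t) (φ : ℝ) {p : Plane}
    (hp : p ∈ frontier A) : ∃ y ∈ frontier K, component φ p + t ≤ |component φ y| := by
  set q : Plane := p + t • unitVec φ with hq
  have hqc : q ∈ closure K := by
    have hv : ‖t • unitVec φ‖ ≤ t := by simp [norm_smul, abs_of_nonneg ht]
    exact map_mem_closure (f := fun x : Plane => x + t • unitVec φ) (by fun_prop)
      (frontier_subset_closure hp) fun x hx => hsub x hx _ hv
  have hqv : component φ q = component φ p + t := by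
    rw [hq, component_add, component_smul, component_unitVec]; simp
  by_cases hq0 : q = 0
  · refine ⟨_, hK.radialCurve_mem_frontier 0, ?_⟩
    rw [← hqv, hq0]
    simp [component]
  · have hg := hK.gauge_pos hq0
    have hg1 := (gauge_le_one_iff_mem_closure hK.convex hK.mem_nhds).2 hqc
    refine ⟨(gauge K q)⁻¹ • q, ?_, ?_⟩
    · rw [hK.mem_frontier_iff, gauge_smul_of_nonneg (by positivity), smul_eq_mul,
        inv_mul_cancel₀ hg.ne']
    · rw [component_smul, abs_mul, ← hqv, abs_of_pos (inv_pos.2 hg)]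
      have : 1 ≤ (gauge K q)⁻¹ := (one_le_inv₀ hg).2 hg1
      calc _ ≤ |component φ q| := le_abs_self _
        _ ≤ _ := le_mul_of_one_le_left (abs_nonneg _) this

/-- If the `t`-neighbourhood of `K` is contained in `K'`, then the length of `∂K` plus `2πt` is at
most the perimeter of `K'`. -/
lemma two_mul_eVariationOn_add_le_perimeter {K' : Set Plane} (hK' : IsSymmBody K') {t : ℝ}
    (ht : 0 ≤ t) (hsub : ∀ x ∈ K, ∀ v, ‖v‖ ≤ t → x + v ∈ K') :
    2 * (eVariationOn (radialCurve K) (Icc 0 Real.pi) + ENNReal.ofReal (Real.pi * t)) ≤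
      perimeter K' := by
  obtain ⟨C, hC⟩ := hK'.exists_lipschitzWith_radialCurve
  have hπ := Real.pi_pos
  have hfin := hK'.perimeter_lt_top.ne
  set γ := radialCurve K with hγ
  set γ' := radialCurve K' with hγ'
  have hpoly : ∀ (n : ℕ) (u : ℕ → ℝ), Monotone u → (∀ i, u i ∈ Icc 0 Real.pi) →
      2 * (∑ i ∈ Finset.range n, ‖γ (u (i + 1)) - γ (u i)‖ + Real.pi * t) ≤
        (perimeter K').toReal := by
    intro n u hu hmem
    have hN : ∀ N : ℕ, 0 < N →
        2 * (∑ i ∈ Finset.range n, ‖γ (u (i + 1)) - γ (u i)‖ + Real.pi * t) ≤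
          (perimeter K').toReal + 2 * C * Real.pi ^ 2 * (1 / N) := by
      intro N hN
      have hN0 : (0 : ℝ) < N := by exact_mod_cast hN
      -- The comparison in one direction; integrating it over all `φ` with `integral_abs_component`
      -- turns projected chords into chord lengths. The error from the mesh vanishes as `N → ∞`.
      have hpt : ∀ φ, ∑ i ∈ Finset.range n, |component φ (γ (u (i + 1)) - γ (u i))| + 2 * t ≤
          ∑ j ∈ Finset.range N, |component φ (γ' (((j + 1 : ℕ) : ℝ) * (Real.pi / N)) -
            γ' ((j : ℝ) * (Real.pi / N)))| + 2 * (C * (Real.pi / N)) := by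
        intro φ
        obtain ⟨p, hp, hp0, hvar⟩ := hK.exists_eVariationOn_component_le φ
        obtain ⟨y, hy, hyp⟩ := hK'.exists_component_add_le hsub ht φ hp
        have h1 := hK'.two_mul_abs_component_le hC φ hy N hN
        have h2 := (eVariationOn.sum_le (f := fun θ => component φ (γ θ)) (n := n) hu hmem).trans
          hvar
        simp only [edist_dist] at h2
        rw [← ENNReal.ofReal_sum_of_nonneg (fun _ _ => dist_nonneg),
          ENNReal.ofReal_le_ofReal_iff (by positivity)] at h2
        simp only [Real.dist_eq, ← component_sub] at h2
        linarith
      have hcontK : Continuous fun φ =>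
          ∑ i ∈ Finset.range n, |component φ (γ (u (i + 1)) - γ (u i))| :=
        continuous_finsetSum _ fun i _ => (continuous_component_left _).abs
      have hcontK' : Continuous fun φ =>
          ∑ j ∈ Finset.range N, |component φ (γ' (((j + 1 : ℕ) : ℝ) * (Real.pi / N)) -
            γ' ((j : ℝ) * (Real.pi / N)))| :=
        continuous_finsetSum _ fun i _ => (continuous_component_left _).abs
      have hint := intervalIntegral.integral_mono_on (μ := volume) (a := 0) (b := 2 * Real.pi)
        (by positivity)
        ((hcontK.add continuous_const).intervalIntegrable _ _)
        ((hcontK'.add continuous_const).intervalIntegrable _ _) (fun φ _ => hpt φ)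
      simp only [Pi.add_apply] at hint
      rw [intervalIntegral.integral_add (hcontK.intervalIntegrable _ _)
          (continuous_const.intervalIntegrable _ _),
        intervalIntegral.integral_add (hcontK'.intervalIntegrable _ _)
          (continuous_const.intervalIntegrable _ _),
        intervalIntegral.integral_finsetSum
          (fun i _ => (continuous_component_left _).abs.intervalIntegrable _ _),
        intervalIntegral.integral_finsetSum
          (fun i _ => (continuous_component_left _).abs.intervalIntegrable _ _)] at hint
      simp only [integral_abs_component, intervalIntegral.integral_const, smul_eq_mul, sub_zero,
        ← Finset.mul_sum] at hint
      have hper := hK'.two_mul_sum_edist_le_perimeter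
        (u := fun j : ℕ => (j : ℝ) * (Real.pi / N))
        (fun i j hij => by dsimp only; gcongr) N (by simp)
        (by rw [mul_div_cancel₀ _ hN0.ne'])
      simp only [edist_dist] at hper
      rw [← ENNReal.ofReal_sum_of_nonneg (fun _ _ => dist_nonneg)] at hper
      replace hper := ENNReal.toReal_mono hfin hper
      rw [ENNReal.toReal_mul, ENNReal.toReal_ofReal (Finset.sum_nonneg fun _ _ => dist_nonneg),
        ENNReal.toReal_ofNat] at hper
      simp only [dist_eq_norm] at hper
      have e : 2 * Real.pi * (2 * (C * (Real.pi / N))) = 2 * (2 * C * Real.pi ^ 2 * (1 / N)) := by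
        field_simp
      rw [e] at hint
      linarith
    have hlim : Filter.Tendsto (fun N : ℕ =>
        (perimeter K').toReal + 2 * C * Real.pi ^ 2 * (1 / (N : ℝ))) Filter.atTop
        (nhds ((perimeter K').toReal + 2 * C * Real.pi ^ 2 * 0)) :=
      (tendsto_one_div_atTop_nhds_zero_nat.const_mul _).const_add _
    rw [mul_zero, add_zero] at hlim
    exact ge_of_tendsto hlim (Filter.eventually_atTop.2 ⟨1, fun N h => hN N h⟩)
  have : Nonempty (ℕ × { u : ℕ → ℝ // Monotone u ∧ ∀ i, u i ∈ Icc 0 Real.pi }) :=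
    ⟨0, fun _ => 0, monotone_const, fun _ => left_mem_Icc.2 hπ.le⟩
  rw [eVariationOn, ENNReal.iSup_add, ENNReal.mul_iSup]
  refine iSup_le ?_
  rintro ⟨n, u, hu, hmem⟩
  simp only [edist_dist]
  rw [← ENNReal.ofReal_sum_of_nonneg (fun _ _ => dist_nonneg), ← ENNReal.ofReal_add
    (Finset.sum_nonneg fun _ _ => dist_nonneg) (by positivity)]
  have h := ENNReal.ofReal_le_of_le_toReal (hpoly n u hu hmem)
  rw [ENNReal.ofReal_mul (by norm_num), ENNReal.ofReal_ofNat] at h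
  simpa only [dist_eq_norm] using h

end IsSymmBody

/-! ### Unit-speed parametrization and the moment bound. -/

/-- The line integral of `F` along a `1`-Lipschitz curve bounds the integral of `F` over its
image. -/
lemma lintegral_image_hausdorffMeasure_le {G : ℝ → Plane} (hG : LipschitzWith 1 G) (I : Set ℝ)
    {F : Plane → ℝ≥0∞} (hF : Measurable F) :
    ∫⁻ x in G '' I, F x ∂(Measure.hausdorffMeasure 1) ≤ ∫⁻ s in I, F (G s) := by
  have hle : (Measure.hausdorffMeasure 1 : Measure Plane).restrict (G '' I) ≤
      (volume.restrict I).map G := by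
    refine Measure.le_intro fun s hs _ => ?_
    have hGm := hG.continuous.measurable
    rw [Measure.restrict_apply hs, Measure.map_apply hGm hs, Measure.restrict_apply (hGm hs)]
    have : s ∩ G '' I ⊆ G '' (G ⁻¹' s ∩ I) := by
      rintro _ ⟨h1, x, hx, rfl⟩
      exact ⟨x, ⟨h1, hx⟩, rfl⟩
    refine (measure_mono this).trans ((hG.hausdorffMeasure_image_le zero_le_one _).trans ?_)
    simp [hausdorffMeasure_real]
  refine (lintegral_mono' hle le_rfl).trans ?_
  rw [lintegral_map hF hG.continuous.measurable]

/-- A Lipschitz curve of length `a` factors through a `1`-Lipschitz curve parametrized by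
`[0, a]`. -/
lemma exists_unitSpeed {γ : ℝ → Plane} {C : NNReal} (hγ : LipschitzWith C γ) {b : ℝ}
    (hb : 0 ≤ b) : ∃ G : ℝ → Plane, LipschitzWith 1 G ∧ G 0 = γ 0 ∧
      G (eVariationOn γ (Icc 0 b)).toReal = γ b ∧
      γ '' Icc 0 b ⊆ G '' Icc 0 (eVariationOn γ (Icc 0 b)).toReal := by
  have hbv : LocallyBoundedVariationOn γ (Icc 0 b) := hγ.lipschitzOnWith.locallyBoundedVariationOn
  have h0 : (0 : ℝ) ∈ Icc 0 b := left_mem_Icc.2 hb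
  have hbm : b ∈ Icc 0 b := right_mem_Icc.2 hb
  set v := variationOnFromTo γ (Icc 0 b) 0 with hv
  set g := naturalParameterization γ (Icc 0 b) 0 with hg
  have hv0 : v 0 = 0 := variationOnFromTo.self _ _ _
  have hvb : v b = (eVariationOn γ (Icc 0 b)).toReal := by
    rw [hv, variationOnFromTo.eq_of_le _ _ hb, inter_self]
  have hgv : ∀ x ∈ Icc 0 b, g (v x) = γ x := fun x hx =>
    edist_eq_zero.1 (edist_naturalParameterization_eq_zero hbv h0 hx)
  have hmono : MonotoneOn v (Icc 0 b) := variationOnFromTo.monotoneOn hbv h0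
  -- Arclength is itself Lipschitz, hence continuous, so it takes every value in `[0, v b]` and the
  -- natural parametrization is controlled on that whole interval.
  have hvl : LipschitzOnWith C v (Icc 0 b) := by
    refine LipschitzOnWith.of_le_add_mul C fun x hx y hy => ?_
    have hadd : v x = v y + variationOnFromTo γ (Icc 0 b) y x :=
      (variationOnFromTo.add hbv h0 hy hx).symm
    rw [hadd]
    gcongr
    rcases le_total y x with hyx | hxy
    · rw [variationOnFromTo.eq_of_le _ _ hyx]
      refine ENNReal.toReal_le_of_le_ofReal (by positivity) ?_
      refine (eVariationOn.mono γ inter_subset_right).trans ?_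
      have := hγ.lipschitzOnWith (s := univ) |>.comp_eVariationOn_le (g := id) (s := Icc y x)
        (mapsTo_univ _ _)
      rw [eVariationOn_id_Icc] at this
      refine this.trans (le_of_eq ?_)
      rw [ENNReal.ofReal_mul (by positivity), Real.dist_eq, abs_of_nonneg (by linarith)]
      simp
    · exact (variationOnFromTo.nonpos_of_ge _ _ hxy).trans (by positivity)
  have himg : v '' Icc 0 b = Icc 0 (v b) := by
    apply Subset.antisymm
    · rintro _ ⟨x, hx, rfl⟩
      exact ⟨hv0 ▸ hmono h0 hx hx.1, hmono hx hbm hx.2⟩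
    · have := intermediate_value_Icc hb hvl.continuousOn
      rwa [hv0] at this
  have hvb0 : 0 ≤ v b := hv0 ▸ hmono h0 hbm hb
  have hgl : ∀ x ∈ Icc 0 (v b), ∀ y ∈ Icc 0 (v b), dist (g x) (g y) ≤ dist x y := by
    have key : ∀ x ∈ Icc 0 b, ∀ y ∈ Icc 0 b, x ≤ y → dist (γ x) (γ y) ≤ dist (v x) (v y) := by
      intro x hx y hy hxy
      have hadd : v x + variationOnFromTo γ (Icc 0 b) x y = v y :=
        variationOnFromTo.add hbv h0 hx hy
      have h1 := variationOnFromTo.eq_of_le γ (Icc 0 b) hxy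
      have h2 := eVariationOn.edist_le γ (s := Icc 0 b ∩ Icc x y) ⟨hx, left_mem_Icc.2 hxy⟩
        ⟨hy, right_mem_Icc.2 hxy⟩
      have h3 := ENNReal.toReal_mono (hbv x y hx hy) h2
      rw [← h1, edist_dist, ENNReal.toReal_ofReal dist_nonneg] at h3
      rw [Real.dist_eq, abs_sub_comm]
      exact h3.trans ((by linarith : _ ≤ v y - v x).trans (le_abs_self _))
    intro x hx y hy
    rw [← himg] at hx hy
    obtain ⟨x, hx, rfl⟩ := hx
    obtain ⟨y, hy, rfl⟩ := hy
    rw [hgv x hx, hgv y hy]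
    rcases le_total x y with h | h
    · exact key x hx y hy h
    · rw [dist_comm, dist_comm (v x)]; exact key y hy x hx h
  -- Clamping the parameter extends the curve to all of `ℝ` without increasing the Lipschitz
  -- constant.
  refine ⟨fun s => g (projIcc 0 (v b) hvb0 s), ?_, ?_, ?_, ?_⟩
  · refine LipschitzWith.of_dist_le_mul fun x y => ?_
    refine (hgl _ (Subtype.mem _) _ (Subtype.mem _)).trans ?_
    exact (LipschitzWith.projIcc hvb0).dist_le_mul x y
  · simp only [projIcc_left]
    rw [← hgv 0 h0, hv0]
  · rw [← hvb]
    simp only [projIcc_right]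
    rw [hgv b hbm]
  · rintro _ ⟨x, hx, rfl⟩
    have hvx : v x ∈ Icc 0 (v b) := himg ▸ mem_image_of_mem v hx
    refine ⟨v x, hvb ▸ hvx, ?_⟩
    simp only [projIcc_of_mem hvb0 hvx]
    exact hgv x hx

namespace IsSymmBody

variable {K : Set Plane} (hK : IsSymmBody K)
include hK

/-- The isoperimetric inequality for the moment of inertia of the boundary of `K`, in terms of the
length of half the boundary. -/
lemma boundaryMoment_le {a : ℝ}
    (ha : a = (eVariationOn (radialCurve K) (Icc 0 Real.pi)).toReal) :
    boundaryMoment K 0 ≤ ENNReal.ofReal (2 * a ^ 3 / Real.pi ^ 2) := by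
  obtain ⟨C, hC⟩ := hK.exists_lipschitzWith_radialCurve
  obtain ⟨G, hG, hG0, hGa, hsub⟩ := exists_unitSpeed hC Real.pi_pos.le
  rw [← ha] at hGa hsub
  have ha0 : 0 ≤ a := ha ▸ ENNReal.toReal_nonneg
  have hanti : G a = -G 0 := by
    rw [hGa, hG0, ← hK.radialCurve_add_pi, zero_add]
  set H : ℝ → Plane := fun s => -G s with hH
  have hHl : LipschitzWith 1 H := hG.neg
  -- The boundary is covered by the half-curve and its reflection, which have equal moments.
  have hfr : frontier K ⊆ G '' Icc 0 a ∪ H '' Icc 0 a := by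
    intro x hx
    obtain ⟨θ, hθ, h | h⟩ := hK.exists_radialCurve_eq hx
    · exact Or.inl (hsub ⟨θ, hθ, h.symm⟩)
    · obtain ⟨s, hs, hs'⟩ := hsub ⟨θ, hθ, rfl⟩
      exact Or.inr ⟨s, hs, by rw [hH]; simp only; rw [hs', h]⟩
  have hF : Measurable fun x : Plane => ‖x + 0‖ₑ ^ 2 := by fun_prop
  have hint : ∫⁻ s in Icc 0 a, ‖G s‖ₑ ^ 2 ≤ ENNReal.ofReal (a ^ 3 / Real.pi ^ 2) := by
    have hc : Continuous fun s => ‖G s‖ ^ 2 := by have := hG.continuous; fun_prop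
    have e : ∀ s, ‖G s‖ₑ ^ 2 = ENNReal.ofReal (‖G s‖ ^ 2) := fun s => by
      rw [ENNReal.ofReal_pow (norm_nonneg _), ofReal_norm]
    simp_rw [e]
    rw [← ofReal_integral_eq_lintegral_ofReal (hc.integrableOn_Icc)
      (Filter.Eventually.of_forall fun s => by positivity), integral_Icc_eq_integral_Ioc,
      ← intervalIntegral.integral_of_le ha0]
    exact ENNReal.ofReal_le_ofReal (integral_norm_sq_le_of_antipodal hG ha0 hanti)
  calc boundaryMoment K 0
      ≤ ∫⁻ x in G '' Icc 0 a ∪ H '' Icc 0 a, ‖x + 0‖ₑ ^ 2 ∂(Measure.hausdorffMeasure 1) :=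
        lintegral_mono_set hfr
    _ ≤ _ := lintegral_union_le _ _ _
    _ ≤ ENNReal.ofReal (a ^ 3 / Real.pi ^ 2) + ENNReal.ofReal (a ^ 3 / Real.pi ^ 2) := by
        gcongr
        · refine (lintegral_image_hausdorffMeasure_le hG _ hF).trans ?_
          simpa only [add_zero] using hint
        · refine (lintegral_image_hausdorffMeasure_le hHl _ hF).trans ?_
          simpa only [add_zero, hH, enorm_neg] using hint
    _ = _ := by
        rw [← ENNReal.ofReal_add (by positivity) (by positivity)]
        congr 1
        ring

/-! ### Inner parallel sets. -/

lemma frontier_nonempty : (frontier K).Nonempty := ⟨_, hK.radialCurve_mem_frontier 0⟩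

lemma isCompact_frontier : IsCompact (frontier K) :=
  Metric.isCompact_of_isClosed_isBounded isClosed_frontier
    (hK.isBounded.closure.subset frontier_subset_closure)

/-- The inner parallel set consists of the centres of the disks of radius `t` inside `K`. -/
lemma mem_innerParallel_iff {t : ℝ} (ht : 0 ≤ t) {x : Plane} :
    x ∈ innerParallel K t ↔ closedBall x t ⊆ K := by
  constructor
  · rintro ⟨hx, hlt⟩
    by_contra hns
    have hconn : IsPreconnected (closedBall x t) := (convex_closedBall x t).isPreconnected
    have hne : (closedBall x t ∩ Kᶜ).Nonempty := by
      obtain ⟨y, hy, hyK⟩ := Set.not_subset.1 hns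
      exact ⟨y, hy, hyK⟩
    -- A connected disk that meets both `K` and its complement must meet the boundary, contradicting
    -- the distance bound.
    have hfr : (closedBall x t ∩ frontier K).Nonempty := by
      by_contra hemp
      rw [Set.not_nonempty_iff_eq_empty] at hemp
      have hcov : closedBall x t ⊆ K ∪ (closure K)ᶜ := by
        intro z hz
        by_contra hcon
        simp only [mem_union, mem_compl_iff, not_or, not_not] at hcon
        have : z ∈ closedBall x t ∩ frontier K :=
          ⟨hz, hcon.2, by rw [hK.isOpen.interior_eq]; exact hcon.1⟩
        rw [hemp] at this
        exact this
      obtain ⟨y, hy, hyK⟩ := hne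
      obtain ⟨z, -, hz1, hz2⟩ := hconn K (closure K)ᶜ hK.isOpen isClosed_closure.isOpen_compl hcov
        ⟨x, mem_closedBall_self ht, hx⟩ ⟨y, hy, (hcov hy).resolve_left hyK⟩
      exact hz2 (subset_closure hz1)
    obtain ⟨z, hz, hzf⟩ := hfr
    have := infDist_le_dist_of_mem (x := x) hzf
    rw [mem_closedBall, dist_comm] at hz
    unfold boundaryDist at hlt
    linarith
  · intro h
    refine ⟨h (mem_closedBall_self ht), ?_⟩
    obtain ⟨p, hp, hpd⟩ := hK.isCompact_frontier.exists_infDist_eq_dist hK.frontier_nonempty x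
    unfold boundaryDist
    by_contra hle
    push Not at hle
    have hpK : p ∈ K := h (by rw [mem_closedBall, dist_comm, ← hpd]; exact hle)
    rw [hK.isOpen.frontier_eq] at hp
    exact hp.2 hpK

/-- By the disk description, the set is the intersection of the translates of `K` by vectors of norm
at most `t`, so it inherits convexity and symmetry. -/
lemma innerParallel_isSymmBody {t : ℝ} (ht : 0 ≤ t) (hne : (innerParallel K t).Nonempty) :
    IsSymmBody (innerParallel K t) where
  isOpen := hK.isOpen.inter (isOpen_lt continuous_const (continuous_infDist_pt _))
  nonempty := hne
  isBounded := hK.isBounded.subset fun _ hx => hx.1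
  convex := by
    intro x hx y hy a b ha hb hab
    rw [hK.mem_innerParallel_iff ht] at hx hy ⊢
    intro z hz
    set v := z - (a • x + b • y) with hv
    have hvt : ‖v‖ ≤ t := by rw [hv, ← dist_eq_norm]; exact hz
    have h1 : x + v ∈ K := hx (by simpa [mem_closedBall, dist_eq_norm] using hvt)
    have h2 : y + v ∈ K := hy (by simpa [mem_closedBall, dist_eq_norm] using hvt)
    have h3 := hK.convex h1 h2 ha hb hab
    have e : a • (x + v) + b • (y + v) = z := by
      rw [smul_add, smul_add, add_add_add_comm, ← add_smul, hab, one_smul, hv]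
      abel
    rwa [e] at h3
  neg_mem := by
    intro x hx
    rw [hK.mem_innerParallel_iff ht] at hx ⊢
    intro z hz
    rw [← neg_neg z]
    refine hK.neg_mem _ (hx ?_)
    rw [mem_closedBall, dist_eq_norm] at hz ⊢
    rwa [← norm_neg, neg_sub, sub_neg_eq_add, add_comm, ← sub_neg_eq_add]

/-- The boundary of the inner parallel set at distance `t` is shorter by at least `2πt`. -/
lemma two_mul_eVariationOn_innerParallel_le {t : ℝ} (ht : 0 ≤ t)
    (hne : (innerParallel K t).Nonempty) :
    2 * (eVariationOn (radialCurve (innerParallel K t)) (Icc 0 Real.pi) +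
      ENNReal.ofReal (Real.pi * t)) ≤ perimeter K := by
  refine (hK.innerParallel_isSymmBody ht hne).two_mul_eVariationOn_add_le_perimeter hK ht ?_
  intro x hx v hv
  exact (hK.mem_innerParallel_iff ht).1 hx (by simpa [mem_closedBall, dist_eq_norm] using hv)

lemma eVariationOn_pos : 0 < eVariationOn (radialCurve K) (Icc 0 Real.pi) := by
  refine lt_of_lt_of_le ?_ (eVariationOn.edist_le (radialCurve K)
    (left_mem_Icc.2 Real.pi_pos.le) (right_mem_Icc.2 Real.pi_pos.le))
  rw [edist_pos]
  intro h
  have h1 := hK.radialCurve_add_pi 0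
  rw [zero_add, ← h] at h1
  replace h1 : radialCurve K 0 = 0 := by
    have h2 := add_eq_zero_iff_eq_neg.2 h1
    rw [← two_smul ℝ] at h2
    exact (smul_eq_zero.1 h2).resolve_left two_ne_zero
  have h2 := hK.mem_frontier_iff.1 (hK.radialCurve_mem_frontier 0)
  rw [h1, gauge_zero] at h2
  norm_num at h2

lemma perimeter_pos : 0 < perimeter K := by
  have h := hK.two_mul_eVariationOn_add_le_perimeter hK le_rfl (fun x hx v hv => by
    rw [norm_le_zero_iff.1 hv, add_zero]; exact hx)
  refine lt_of_lt_of_le ?_ h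
  have := hK.eVariationOn_pos
  rw [ENNReal.mul_pos_iff]
  exact ⟨by norm_num, lt_of_lt_of_le this le_self_add⟩

end IsSymmBody

/-! ### The disk and the conclusion. -/

lemma isSymmBody_ball {r : ℝ} (hr : 0 < r) : IsSymmBody (ball (0 : Plane) r) where
  isOpen := isOpen_ball
  nonempty := nonempty_ball.2 hr
  isBounded := isBounded_ball
  convex := convex_ball 0 r
  neg_mem := by intro x hx; simpa using hx

/-- The perimeter of a disk. -/
lemma perimeter_ball {r : ℝ} (hr : 0 < r) :
    perimeter (ball (0 : Plane) r) = ENNReal.ofReal (2 * Real.pi * r) := by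
  have hπ := Real.pi_pos
  have hK := isSymmBody_ball hr
  apply le_antisymm
  · have hL : LipschitzWith (Real.toNNReal r) fun θ => r • unitVec θ := by
      refine LipschitzWith.of_dist_le_mul fun a b => ?_
      rw [dist_eq_norm, ← smul_sub, norm_smul, Real.norm_of_nonneg hr.le, Real.dist_eq,
        Real.coe_toNNReal _ hr.le]
      exact mul_le_mul_of_nonneg_left (norm_unitVec_sub_le a b) hr.le
    have hsub : frontier (ball (0 : Plane) r) ⊆ (fun θ => r • unitVec θ) '' Ico 0 (2 * Real.pi) := by
      intro x hx
      rw [frontier_ball _ hr.ne', mem_sphere_zero_iff_norm] at hx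
      obtain ⟨θ, hθ, h⟩ := exists_eq_smul_unitVec x
      exact ⟨θ, hθ, by rw [h, hx]⟩
    refine (measure_mono hsub).trans ((hL.hausdorffMeasure_image_le zero_le_one _).trans ?_)
    rw [hausdorffMeasure_real, Real.volume_Ico, ENNReal.rpow_one, sub_zero, mul_comm]
    exact (ENNReal.ofReal_mul (by positivity)).ge
  · have h1 : ∀ t ∈ Ioo 0 r, 2 * Real.pi * t ≤ (perimeter (ball (0 : Plane) r)).toReal := by
      intro t ht
      have h0 : (0 : Plane) ∈ innerParallel (ball (0 : Plane) r) t := by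
        rw [hK.mem_innerParallel_iff ht.1.le]
        exact closedBall_subset_ball ht.2
      have := hK.two_mul_eVariationOn_innerParallel_le ht.1.le ⟨0, h0⟩
      have h2 : ENNReal.ofReal (2 * Real.pi * t) ≤ perimeter (ball (0 : Plane) r) := by
        refine le_trans ?_ this
        rw [mul_assoc, ENNReal.ofReal_mul (by norm_num), ENNReal.ofReal_ofNat]
        gcongr
        exact le_add_self
      exact (ENNReal.ofReal_le_iff_le_toReal hK.perimeter_lt_top.ne).1 h2
    refine ENNReal.ofReal_le_of_le_toReal ?_
    have hlim : Filter.Tendsto (fun t : ℝ => 2 * Real.pi * t) (nhdsWithin r (Iio r))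
        (nhds (2 * Real.pi * r)) :=
      ((continuous_const.mul continuous_id).tendsto r).mono_left nhdsWithin_le_nhds
    exact le_of_tendsto hlim (Filter.eventually_of_mem (Ioo_mem_nhdsLT hr) h1)

lemma innerParallel_ball {r t : ℝ} (ht : 0 < t) (htr : t < r) :
    innerParallel (ball (0 : Plane) r) t = ball 0 (r - t) := by
  ext x
  rw [(isSymmBody_ball (ht.trans htr)).mem_innerParallel_iff ht.le, mem_ball_zero_iff]
  constructor
  · intro h
    obtain ⟨θ, -, hx⟩ := exists_eq_smul_unitVec x
    have h1 : x + t • unitVec θ ∈ ball (0 : Plane) r := by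
      apply h
      simp [mem_closedBall, dist_eq_norm, norm_smul, abs_of_pos ht]
    have e : x + t • unitVec θ = (‖x‖ + t) • unitVec θ := by rw [add_smul, ← hx]
    rw [e, mem_ball_zero_iff, norm_smul, norm_unitVec, mul_one,
      Real.norm_of_nonneg (by positivity)] at h1
    linarith
  · intro h
    exact closedBall_subset_ball' (by rw [dist_zero_right]; linarith)

lemma boundaryMoment_ball {r : ℝ} (hr : 0 < r) :
    boundaryMoment (ball (0 : Plane) r) 0 = ENNReal.ofReal (2 * Real.pi * r ^ 3) := by
  have hp := perimeter_ball hr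
  unfold perimeter at hp
  unfold boundaryMoment
  rw [frontier_ball _ hr.ne'] at hp ⊢
  rw [setLIntegral_congr_fun (g := fun _ => ENNReal.ofReal (r ^ 2)) isClosed_sphere.measurableSet,
    setLIntegral_const, hp, ← ENNReal.ofReal_mul (by positivity)]
  · congr 1; ring
  · intro x hx
    simp only [add_zero]
    rw [← ofReal_norm, mem_sphere_zero_iff_norm.1 hx, ENNReal.ofReal_pow hr.le]

theorem proposition3p4 (Ω : Set Plane) (hopen : IsOpen Ω) (hne : Ω.Nonempty)
    (hbdd : Bornology.IsBounded Ω) (hC2 : HasC2Boundary Ω)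
    (hconv : Convex ℝ Ω) (hsymm : CentrallySymmetric Ω)
    (R : ℝ) (hR : R = (perimeter Ω).toReal / (2 * Real.pi)) :
    0 < R ∧ perimeter (ball 0 R) = perimeter Ω ∧ SubordinateToDisk Ω R := by
  have hπ := Real.pi_pos
  have hΩ : IsSymmBody Ω := ⟨hopen, hne, hbdd, hconv, fun x hx => by
    rw [CentrallySymmetric] at hsymm
    exact hsymm ▸ mem_image_of_mem _ hx⟩
  have hfin := hΩ.perimeter_lt_top.ne
  have hRpos : 0 < R := by
    rw [hR]
    have := ENNReal.toReal_pos hΩ.perimeter_pos.ne' hfin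
    positivity
  have hL : perimeter Ω = ENNReal.ofReal (2 * Real.pi * R) := by
    rw [hR, mul_div_cancel₀ _ (by positivity), ENNReal.ofReal_toReal hfin]
  refine ⟨hRpos, (perimeter_ball hRpos).trans hL.symm, 0, ?_⟩
  refine (ae_restrict_iff' measurableSet_Ioo).2 (Filter.Eventually.of_forall fun t ht => ?_)
  have hneT : (innerParallel Ω t).Nonempty := by
    obtain ⟨_, ⟨x, hx, rfl⟩, hlt⟩ := exists_lt_of_lt_csSup (hne.image _) ht.2
    exact ⟨x, hx, hlt⟩
  have hT := hΩ.innerParallel_isSymmBody ht.1.le hneT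
  have hle := hΩ.two_mul_eVariationOn_innerParallel_le ht.1.le hneT
  have hpos := hT.eVariationOn_pos
  have hmom := hT.boundaryMoment_le rfl
  set V := eVariationOn (radialCurve (innerParallel Ω t)) (Icc 0 Real.pi)
  have hVfin : V ≠ ∞ := by
    intro h
    rw [h] at hle
    simp at hle
    exact hfin hle
  have hVpos : 0 < V.toReal := ENNReal.toReal_pos hpos.ne' hVfin
  have hVle : V.toReal ≤ Real.pi * (R - t) := by
    have := ENNReal.toReal_mono hfin hle
    rw [ENNReal.toReal_mul, ENNReal.toReal_add hVfin ENNReal.ofReal_ne_top,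
      ENNReal.toReal_ofReal (by have := ht.1; positivity), hL,
      ENNReal.toReal_ofReal (by positivity), ENNReal.toReal_ofNat] at this
    linarith
  -- Positivity of the inner length forces `t < R`, so the inner disk is genuine.
  have htR : t < R := by
    have := hVpos.trans_le hVle
    linarith [(mul_pos_iff_of_pos_left hπ).1 this]
  rw [innerParallel_ball ht.1 htR, boundaryMoment_ball (sub_pos.2 htR)]
  refine ⟨rfl, hmom.trans (ENNReal.ofReal_le_ofReal ?_)⟩
  rw [div_le_iff₀ (by positivity)]
  have := pow_le_pow_left₀ hVpos.le hVle 3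
  nlinarith
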